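/- Let $q>1$ and $\kappa>0$. Then the equation $\Delta^2 u + u^{-q} = 0$ in $\mathbb R^3$ has infinitely many positive radially symmetric solutions $u \in C^4(\mathbb R^3)$ with $$\lim_{|x|\to\infty} \frac{u(x)}{|x|^2} = \kappa .$$ Furthermore, every positive radially symmetric solution $u \in C^4(\mathbb R^3)$ of this equation with this limit at infinity, written $u(x)=u(|x|)$, satisfies $\int_0^\infty t\,u(t)^{-q}\,dt<\infty$ and $$6\kappa = (\Delta u)(0) - \int_0^\infty t\,u(t)^{-q}\,dt .$$ -/

import Mathlib

open Filter Topology MeasureTheory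
open scoped Laplacian

/-- Three-dimensional Euclidean space. -/
abbrev E3 : Type := EuclideanSpace ℝ (Fin 3)

/-- `u` is radially symmetric with radial profile `f`: `u x = f |x|`. The values of `f` on
`[0, ∞)` are determined by `u`; those on the negative half-line play no role. -/
def HasProfile (u : E3 → ℝ) (f : ℝ → ℝ) : Prop :=
  ∀ x : E3, u x = f ‖x‖

/-- `u` is radially symmetric about the origin. -/
def IsRadial (u : E3 → ℝ) : Prop :=
  ∃ f : ℝ → ℝ, HasProfile u f

/-- `u` is a positive classical (that is, `C⁴`) solution of `Δ² u + u ^ (-q) = 0` in the whole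
of three-dimensional Euclidean space. -/
structure IsPositiveSolution (q : ℝ) (u : E3 → ℝ) : Prop where
  contDiff : ContDiff ℝ 4 u
  pos : ∀ x : E3, 0 < u x
  eqn : ∀ x : E3, (Δ (Δ u)) x + (u x) ^ (-q) = 0

/-- `u` has exactly quadratic growth at infinity with coefficient `κ`: `u(x) / |x|² → κ` as
`|x| → ∞`. -/
def HasQuadraticGrowth (κ : ℝ) (u : E3 → ℝ) : Prop :=
  Tendsto (fun x : E3 => u x / ‖x‖ ^ 2) (Bornology.cobounded E3) (𝓝 κ)

/-!
Both halves of the theorem come from one integral operator. For a continuous `h` on the half-line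
put `M h (r) = ∫₀¹ σ² h(σ r) dσ` and `W h (r) = ∫₀ʳ ρ M h (ρ) dρ` (`rayMean`, `radialPotential`).
Then `x ↦ W h |x|` has gradient `M h |x| x`, whose divergence is `h |x|`; it vanishes at the origin
and is therefore the radial solution of `Δ w = h`. If `h → l` at infinity then `W h (r) / r² → l / 6`.
If `t h(t)` is integrable then `W h (r) → ∫₀^∞ t h(t) dt`, because `W h` is the Cesàro average of
`s ↦ ∫₀ˢ t h(t) dt`.

*The identity.* A `C²` function invariant under linear isometries equals its value at the origin
plus `W` of its Laplacian along each ray (`eq_radialPotential_laplacian`). Quadratic growth and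
`q > 1` make `t u ^ (-q)` integrable. Applied to `Δ u`, the representation gives
`Δ u → Δ u (0) - ∫ t u ^ (-q)` at infinity; applied to `u`, it then gives that `u / r²` tends to one
sixth of this limit.

*Existence.* A solution with `u(0) = a` and growth coefficient `κ` has the form
`u = a + W (6κ + h)`, where `h = ∫₀^∞ t u ^ (-q) dt - W (u ^ (-q))` is nonnegative and tends to `0`.
For any `h ≥ 0` this `u` is at least `a + κ r²`, so the right-hand side is a Lipschitz function of `h`
in the sup norm, with a constant of order `∫ t (a + κ t²) ^ (-q) dt`, a multiple of `a ^ (1 - q)`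
(`abs_tailPotential_sub_le`). Hence it is a contraction for every large `a`, and distinct values of
`a` give distinct solutions. The fixed point is only continuous a priori; in three dimensions `M`
preserves `C^k` and the gradient formula shows that `W` gains a derivative, so that `u` is smooth
enough after two rounds (`contDiff_profileOf_norm`).
-/

/-! ### Weighted means along rays -/

/-- The weighted mean `∫₀¹ σʲ H(σ x) dσ` of `H` along the segment from the origin to `x`. For
`j = 2` and radial `H` on three-dimensional space it is one third of the average of `H` over the
ball of radius `‖x‖`. -/
noncomputable def rayMean {E F : Type} [NormedAddCommGroup E] [NormedSpace ℝ E]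
    [NormedAddCommGroup F] [NormedSpace ℝ F] (j : ℕ) (H : E → F) (x : E) : F :=
  ∫ σ in (0 : ℝ)..1, σ ^ j • H (σ • x)

section RayMean

variable {E F : Type} [NormedAddCommGroup E] [NormedSpace ℝ E]
  [NormedAddCommGroup F] [NormedSpace ℝ F]

theorem continuous_rayMean (j : ℕ) {H : E → F} (hH : Continuous H) :
    Continuous (rayMean j H) := by
  unfold rayMean
  apply intervalIntegral.continuous_parametric_intervalIntegral_of_continuous'
  unfold Function.uncurry
  fun_prop

theorem hasFDerivAt_rayMean [ProperSpace E] (j : ℕ) {H : E → F}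
    (hH : ContDiff ℝ 1 H) (x : E) :
    HasFDerivAt (rayMean j H) (rayMean (j + 1) (fderiv ℝ H) x) x := by
  have hc : Continuous (fderiv ℝ H) := hH.continuous_fderiv (by norm_num)
  obtain ⟨C, hC⟩ := (isCompact_closedBall (0 : E) (‖x‖ + 1)).exists_bound_of_continuousOn
    hc.continuousOn
  have hH0 := hH.continuous
  refine intervalIntegral.hasFDerivAt_integral_of_dominated_of_fderiv_le
    (F := fun (y : E) (σ : ℝ) => σ ^ j • H (σ • y))
    (F' := fun (y : E) (σ : ℝ) => σ ^ (j + 1) • fderiv ℝ H (σ • y)) (bound := fun _ => C)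
    (Metric.ball_mem_nhds x one_pos) (Eventually.of_forall fun y => ?_) ?_ ?_ ?_ ?_ ?_
  · exact Continuous.aestronglyMeasurable (by fun_prop)
  · exact Continuous.intervalIntegrable (by fun_prop) _ _
  · exact Continuous.aestronglyMeasurable (by fun_prop)
  · refine Eventually.of_forall fun σ hσ y hy => ?_
    rw [Set.uIoc_of_le zero_le_one] at hσ
    have h1 : ‖y‖ ≤ ‖x‖ + 1 := by
      have := norm_le_norm_add_norm_sub' y x
      rw [Metric.mem_ball, dist_eq_norm] at hy
      linarith
    have h2 : ‖fderiv ℝ H (σ • y)‖ ≤ C := by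
      apply hC
      rw [mem_closedBall_zero_iff, norm_smul, Real.norm_of_nonneg hσ.1.le]
      nlinarith [norm_nonneg y, hσ.2]
    rw [norm_smul, norm_pow, Real.norm_of_nonneg hσ.1.le]
    calc σ ^ (j + 1) * ‖fderiv ℝ H (σ • y)‖ ≤ 1 * ‖fderiv ℝ H (σ • y)‖ := by
          gcongr
          exact pow_le_one₀ hσ.1.le hσ.2
      _ ≤ C := by rwa [one_mul]
  · exact intervalIntegrable_const
  · refine Eventually.of_forall fun σ _ y _ => ?_
    have h1 : HasFDerivAt H (fderiv ℝ H (σ • y)) (σ • y) :=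
      (hH.differentiable (by norm_num) _).hasFDerivAt
    have h2 : HasFDerivAt (fun z : E => σ • z) (σ • ContinuousLinearMap.id ℝ E) y :=
      (hasFDerivAt_id y).const_smul σ
    convert! (h1.comp y h2).const_smul (σ ^ j) using 1
    ext z
    simp [pow_succ, mul_smul]

theorem contDiff_rayMean [ProperSpace E] (j k : ℕ) {H : E → F}
    (hH : ContDiff ℝ k H) : ContDiff ℝ k (rayMean j H) := by
  induction k generalizing F j with
  | zero => exact contDiff_zero.2 (continuous_rayMean j (contDiff_zero.1 hH))
  | succ k ih =>
    have h1 : ContDiff ℝ 1 H := hH.of_le (by norm_cast; omega)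
    have h2 := fun x => hasFDerivAt_rayMean j h1 x
    push_cast at hH ⊢
    rw [contDiff_succ_iff_fderiv] at hH ⊢
    refine ⟨fun x => (h2 x).differentiableAt, by simp, ?_⟩
    rw [show fderiv ℝ (rayMean j H) = rayMean (j + 1) (fderiv ℝ H) from
      funext fun x => (h2 x).fderiv]
    exact ih (j + 1) hH.2.2

theorem pow_smul_rayMean (j : ℕ) (H : E → F) (x : E) (r : ℝ) :
    r ^ (j + 1) • rayMean j H (r • x) = ∫ t in (0 : ℝ)..r, t ^ j • H (t • x) := by
  have h := intervalIntegral.smul_integral_comp_mul_right (a := 0) (b := 1)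
    (fun t : ℝ => t ^ j • H (t • x)) r
  rw [zero_mul, one_mul] at h
  rw [← h, rayMean, pow_succ', mul_smul, ← intervalIntegral.integral_smul]
  congr 2
  ext σ
  rw [mul_pow, mul_smul, mul_smul, smul_comm (σ ^ j)]

/-- In three dimensions the left side is the divergence of `x ↦ M(x) x` with `M = rayMean 2 H`. The
identity is the derivative at `r = 1` of `r³ M(r x) = ∫₀ʳ t² H(t x) dt`. -/
theorem three_smul_rayMean_add_fderiv [CompleteSpace F] {H : E → F} (hH : Continuous H) {x : E}
    (hM : DifferentiableAt ℝ (rayMean 2 H) x) :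
    (3 : ℝ) • rayMean 2 H x + fderiv ℝ (rayMean 2 H) x x = H x := by
  have h1 : HasDerivAt (fun r : ℝ => r ^ (2 + 1) • rayMean 2 H (r • x)) (H x) 1 := by
    have h : HasDerivAt (fun r : ℝ => ∫ t in (0 : ℝ)..r, t ^ 2 • H (t • x))
        ((1 : ℝ) ^ 2 • H ((1 : ℝ) • x)) 1 :=
      intervalIntegral.integral_hasDerivAt_right
        (Continuous.intervalIntegrable (by fun_prop) _ _)
        (Continuous.stronglyMeasurableAtFilter (by fun_prop) _ _)
        (Continuous.continuousAt (by fun_prop))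
    simp only [pow_smul_rayMean]
    simpa using h
  have hM' : HasFDerivAt (rayMean 2 H) (fderiv ℝ (rayMean 2 H) x) ((1 : ℝ) • x) := by
    rw [one_smul]; exact hM.hasFDerivAt
  have h2 : HasDerivAt (fun r : ℝ => r • x) ((1 : ℝ) • x) 1 := (hasDerivAt_id 1).smul_const x
  have h3 := (hasDerivAt_pow (2 + 1) (1 : ℝ)).smul (hM'.comp_hasDerivAt 1 h2)
  have h4 := h3.unique h1
  simp only [Function.comp, one_smul, one_pow, mul_one] at h4
  rw [← h4, add_comm]
  norm_num

end RayMean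

/-! ### The radial potential on the half-line -/

section Potential

/-- The radial profile of the Newtonian-type potential of `h` in three dimensions: with `r = |x|`
it is the solution of `Δ w = h` with `w = 0` at the origin, namely
`∫₀ʳ ρ M(ρ) dρ` with `M = rayMean 2 h`. The substitution `τ = ρ²` makes it a `C¹` function
of `r²`, so that composing it with the norm creates no singularity at the origin. -/
noncomputable def radialPotential (h : ℝ → ℝ) (r : ℝ) : ℝ :=
  (1 / 2) * ∫ τ in (0 : ℝ)..r ^ 2, rayMean 2 h √τ

variable {h k : ℝ → ℝ}

theorem hasDerivAt_half_integral_sqrt (hh : Continuous h) (s : ℝ) :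
    HasDerivAt (fun s : ℝ => (1 / 2) * ∫ τ in (0 : ℝ)..s, rayMean 2 h √τ)
      ((1 / 2) * rayMean 2 h √s) s := by
  have hc : Continuous fun τ => rayMean 2 h √τ :=
    (continuous_rayMean 2 hh).comp Real.continuous_sqrt
  exact (intervalIntegral.integral_hasDerivAt_right (hc.intervalIntegrable _ _)
    (hc.stronglyMeasurableAtFilter _ _) hc.continuousAt).const_mul _

theorem hasDerivAt_radialPotential (hh : Continuous h) {r : ℝ} (hr : 0 ≤ r) :
    HasDerivAt (radialPotential h) (r * rayMean 2 h r) r := by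
  have := (hasDerivAt_half_integral_sqrt hh (r ^ 2)).comp r (hasDerivAt_pow 2 r)
  rw [Real.sqrt_sq hr] at this
  convert! this using 1
  push_cast
  ring

theorem continuous_radialPotential (hh : Continuous h) : Continuous (radialPotential h) := by
  have : Continuous (fun s : ℝ => (1 / 2) * ∫ τ in (0 : ℝ)..s, rayMean 2 h √τ) :=
    continuous_iff_continuousAt.2 fun s => (hasDerivAt_half_integral_sqrt hh s).continuousAt
  exact this.comp (continuous_pow 2)

@[simp] theorem radialPotential_zero (h : ℝ → ℝ) : radialPotential h 0 = 0 := by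
  simp [radialPotential]

theorem radialPotential_abs (h : ℝ → ℝ) (r : ℝ) : radialPotential h |r| = radialPotential h r := by
  simp [radialPotential]

theorem rayMean_mono_of_nonneg (j : ℕ) (hh : Continuous h) (hk : Continuous k) {r : ℝ} (hr : 0 ≤ r)
    (hle : ∀ t, 0 ≤ t → h t ≤ k t) : rayMean j h r ≤ rayMean j k r := by
  refine intervalIntegral.integral_mono_on zero_le_one
    (Continuous.intervalIntegrable (by fun_prop) _ _)
    (Continuous.intervalIntegrable (by fun_prop) _ _) fun σ hσ => ?_
  exact smul_le_smul_of_nonneg_left (hle _ (mul_nonneg hσ.1 hr)) (pow_nonneg hσ.1 j)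

theorem radialPotential_mono (hh : Continuous h) (hk : Continuous k)
    (hle : ∀ t, 0 ≤ t → h t ≤ k t) (r : ℝ) : radialPotential h r ≤ radialPotential k r := by
  refine mul_le_mul_of_nonneg_left (intervalIntegral.integral_mono_on (sq_nonneg r)
    (((continuous_rayMean 2 hh).comp Real.continuous_sqrt).intervalIntegrable _ _)
    (((continuous_rayMean 2 hk).comp Real.continuous_sqrt).intervalIntegrable _ _) fun τ _ => ?_)
    (by norm_num)
  exact rayMean_mono_of_nonneg 2 hh hk (Real.sqrt_nonneg τ) hle

theorem rayMean_const (j : ℕ) (c r : ℝ) : rayMean j (fun _ : ℝ => c) r = c / (j + 1) := by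
  simp [rayMean, integral_pow]
  ring

theorem radialPotential_const (c r : ℝ) : radialPotential (fun _ => c) r = c * r ^ 2 / 6 := by
  simp [radialPotential, rayMean_const]
  ring

theorem radialPotential_nonneg (hh : Continuous h) (h0 : ∀ t, 0 ≤ t → 0 ≤ h t) (r : ℝ) :
    0 ≤ radialPotential h r := by
  have := radialPotential_mono continuous_const hh h0 r
  rwa [radialPotential_const, zero_mul, zero_div] at this

theorem rayMean_sub (j : ℕ) (hh : Continuous h) (hk : Continuous k) (r : ℝ) :
    rayMean j (fun t => h t - k t) r = rayMean j h r - rayMean j k r := by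
  unfold rayMean
  rw [← intervalIntegral.integral_sub (Continuous.intervalIntegrable (by fun_prop) _ _)
    (Continuous.intervalIntegrable (by fun_prop) _ _)]
  simp only [smul_sub]

theorem radialPotential_sub (hh : Continuous h) (hk : Continuous k) (r : ℝ) :
    radialPotential (fun t => h t - k t) r = radialPotential h r - radialPotential k r := by
  unfold radialPotential
  have hM := continuous_rayMean 2 hh
  have kM := continuous_rayMean 2 hk
  simp only [rayMean_sub 2 hh hk]
  rw [intervalIntegral.integral_sub (Continuous.intervalIntegrable (by fun_prop) _ _)
    (Continuous.intervalIntegrable (by fun_prop) _ _), mul_sub]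

theorem abs_radialPotential_sub_le (hh : Continuous h) (hk : Continuous k) {g : ℝ → ℝ}
    (hg : Continuous g) (hle : ∀ t, 0 ≤ t → |h t - k t| ≤ g t) (r : ℝ) :
    |radialPotential h r - radialPotential k r| ≤ radialPotential g r := by
  rw [abs_le, neg_le, neg_sub, ← radialPotential_sub hh hk, ← radialPotential_sub hk hh]
  exact ⟨radialPotential_mono (hk.sub hh) hg
      (fun t ht => ((le_abs_self _).trans_eq (abs_sub_comm _ _)).trans (hle t ht)) r,
    radialPotential_mono (hh.sub hk) hg (fun t ht => (le_abs_self _).trans (hle t ht)) r⟩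

/-- Integration by parts: `∫₀ʳ ρ M(ρ) dρ = ∫₀ʳ t h(t) dt - r² M(r)` with `M = rayMean 2 h`, that
is, `∫₀ʳ t (1 - t / r) h(t) dt`. -/
theorem radialPotential_eq (hh : Continuous h) {r : ℝ} (hr : 0 ≤ r) :
    radialPotential h r = (∫ t in (0 : ℝ)..r, t * h t) - r ^ 2 * rayMean 2 h r := by
  have hM := continuous_rayMean 2 hh
  have hI : ∀ (s : ℝ) (g : ℝ → ℝ), Continuous g →
      HasDerivAt (fun s => ∫ t in (0 : ℝ)..s, g t) (g s) s := fun s g hg =>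
    intervalIntegral.integral_hasDerivAt_right (hg.intervalIntegrable _ _)
      (hg.stronglyMeasurableAtFilter _ _) hg.continuousAt
  -- `s² M(s)` is written as `s⁻¹ ∫₀ˢ t² h(t) dt`, which is differentiable for `s > 0`; at the
  -- origin `M` is merely continuous.
  have key : ∀ s, 0 < s → HasDerivAt (fun s => s ^ 2 * rayMean 2 h s)
      (s * h s - s * rayMean 2 h s) s := by
    intro s hs
    have e : ∀ t : ℝ, t ^ 3 * rayMean 2 h t = ∫ t in (0 : ℝ)..t, t ^ 2 * h t := fun t => by
      simpa using pow_smul_rayMean 2 h 1 t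
    have h1 := (hI s (fun t => t ^ 2 * h t) (by fun_prop)).mul (hasDerivAt_inv hs.ne')
    have h2 : HasDerivAt (fun s => s ^ 2 * rayMean 2 h s)
        (s ^ 2 * h s * s⁻¹ + (∫ t in (0 : ℝ)..s, t ^ 2 * h t) * -(s ^ 2)⁻¹) s := by
      refine h1.congr_of_eventuallyEq ?_
      filter_upwards [lt_mem_nhds hs] with t ht
      simp only [Pi.mul_apply]
      rw [← e]
      field_simp
    rw [← e] at h2
    convert! h2 using 1
    field_simp
    ring
  have hW := continuous_radialPotential hh
  have hc := intervalIntegral.integral_eq_sub_of_hasDerivAt_of_le hr (f' := fun _ => 0)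
    (f := fun s => radialPotential h s + s ^ 2 * rayMean 2 h s - ∫ t in (0 : ℝ)..s, t * h t)
    (Continuous.continuousOn (by fun_prop)) (fun s hs => ?_) intervalIntegrable_const
  · simp at hc
    linarith
  · convert! ((hasDerivAt_radialPotential hh hs.1.le).add (key s hs.1)).sub
      (hI s (fun t => t * h t) (by fun_prop)) using 1
    ring

theorem exists_bound_of_tendsto_atTop (hh : Continuous h) {l : ℝ} (hl : Tendsto h atTop (𝓝 l)) :
    ∃ C, ∀ t, 0 ≤ t → |h t| ≤ C := by
  obtain ⟨T, hT⟩ := eventually_atTop.1 (hl.abs.eventually_le_const (lt_add_one |l|))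
  obtain ⟨C, hC⟩ := (isCompact_Icc (a := 0) (b := T)).exists_bound_of_continuousOn hh.continuousOn
  refine ⟨max C (|l| + 1), fun t ht => ?_⟩
  rcases le_total t T with h1 | h1
  · exact (hC t ⟨ht, h1⟩).trans (le_max_left _ _)
  · exact (hT t h1).trans (le_max_right _ _)

theorem tendsto_rayMean (j : ℕ) (hh : Continuous h) {l : ℝ} (hl : Tendsto h atTop (𝓝 l)) :
    Tendsto (rayMean j h) atTop (𝓝 (l / (j + 1))) := by
  obtain ⟨C, hC⟩ := exists_bound_of_tendsto_atTop hh hl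
  rw [← rayMean_const j l 1]
  refine intervalIntegral.tendsto_integral_filter_of_dominated_convergence (fun _ => C)
    (Eventually.of_forall fun r => Continuous.aestronglyMeasurable (by fun_prop)) ?_
    intervalIntegrable_const (Eventually.of_forall fun σ hσ => ?_)
  · filter_upwards [eventually_ge_atTop 0] with r hr
    refine Eventually.of_forall fun σ hσ => ?_
    rw [Set.uIoc_of_le zero_le_one] at hσ
    have h1 := hC (σ • r) (mul_nonneg hσ.1.le hr)
    rw [norm_smul, norm_pow, Real.norm_of_nonneg hσ.1.le, Real.norm_eq_abs]
    calc σ ^ j * |h (σ • r)| ≤ 1 * |h (σ • r)| := by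
          gcongr
          exact pow_le_one₀ hσ.1.le hσ.2
      _ ≤ C := by rwa [one_mul]
  · rw [Set.uIoc_of_le zero_le_one] at hσ
    exact (hl.comp (tendsto_id.const_mul_atTop hσ.1)).const_smul _

theorem tendsto_radialPotential_div_sq (hh : Continuous h) {l : ℝ}
    (hl : Tendsto h atTop (𝓝 l)) :
    Tendsto (fun r => radialPotential h r / r ^ 2) atTop (𝓝 (l / 6)) := by
  -- After `τ = ρ²`, the quotient `W h (r) / r²` is half of a plain mean of `M h ∘ √` at `r²`.
  have h1 : Tendsto (fun s => rayMean 2 h √s) atTop (𝓝 (l / 3)) := by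
    have := (tendsto_rayMean 2 hh hl).comp Real.tendsto_sqrt_atTop
    norm_num at this
    exact this
  have h2 := (tendsto_rayMean 0 ((continuous_rayMean 2 hh).comp Real.continuous_sqrt) h1).comp
    (tendsto_pow_atTop (α := ℝ) two_ne_zero)
  have h3 := h2.const_mul (1 / 2)
  rw [show (1 / 2 : ℝ) * (l / 3 / ((0 : ℕ) + 1)) = l / 6 by push_cast; ring] at h3
  refine h3.congr' ?_
  filter_upwards [eventually_gt_atTop 0] with r hr
  have e := pow_smul_rayMean 0 ((rayMean 2 h) ∘ Real.sqrt) (1 : ℝ) (r ^ 2)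
  simp only [smul_eq_mul, mul_one, pow_zero, one_mul, zero_add, pow_one, Function.comp] at e
  unfold radialPotential
  rw [← e]
  simp only [Function.comp]
  field_simp

/-- The potential is the Cesàro average over `[0, r]` of `s ↦ ∫₀ˢ t h(t) dt`. -/
theorem radialPotential_eq_rayMean (hh : Continuous h) {r : ℝ} (hr : 0 < r) :
    radialPotential h r = rayMean 0 (fun s => ∫ t in (0 : ℝ)..s, t * h t) r := by
  have hP : Continuous fun s => ∫ t in (0 : ℝ)..s, t * h t := by fun_prop
  have e := pow_smul_rayMean 0 (fun s => ∫ t in (0 : ℝ)..s, t * h t) (1 : ℝ) r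
  simp only [smul_eq_mul, mul_one, pow_zero, one_mul, zero_add, pow_one] at e
  have h1 : ∫ s in (0 : ℝ)..r, (∫ t in (0 : ℝ)..s, t * h t) =
      r * radialPotential h r - 0 * radialPotential h 0 := by
    refine intervalIntegral.integral_eq_sub_of_hasDerivAt
      (f := fun s => s * radialPotential h s) (fun s hs => ?_) (hP.intervalIntegrable _ _)
    rw [Set.uIcc_of_le hr.le] at hs
    convert! (hasDerivAt_id s).mul (hasDerivAt_radialPotential hh hs.1) using 1
    rw [radialPotential_eq hh hs.1]
    simp only [id]
    ring
  rw [h1, zero_mul, sub_zero] at e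
  exact (mul_left_cancel₀ hr.ne' e).symm

theorem tendsto_radialPotential (hh : Continuous h)
    (hi : IntegrableOn (fun t => t * h t) (Set.Ioi 0)) :
    Tendsto (radialPotential h) atTop (𝓝 (∫ t in Set.Ioi (0 : ℝ), t * h t)) := by
  have h1 := tendsto_rayMean 0 (h := fun s => ∫ t in (0 : ℝ)..s, t * h t) (by fun_prop)
    (intervalIntegral_tendsto_integral_Ioi 0 hi tendsto_id)
  simp only [Nat.cast_zero, zero_add, div_one] at h1
  refine h1.congr' ?_
  filter_upwards [eventually_gt_atTop 0] with r hr
  exact (radialPotential_eq_rayMean hh hr).symm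

theorem radialPotential_le_integral (hh : Continuous h) (h0 : ∀ t, 0 ≤ t → 0 ≤ h t)
    (hi : IntegrableOn (fun t => t * h t) (Set.Ioi 0)) (r : ℝ) :
    radialPotential h r ≤ ∫ t in Set.Ioi (0 : ℝ), t * h t := by
  rw [← radialPotential_abs]
  have hM : 0 ≤ rayMean 2 h |r| := by
    have := rayMean_mono_of_nonneg 2 (continuous_const (y := (0 : ℝ))) hh (abs_nonneg r) h0
    rwa [rayMean_const, zero_div] at this
  have h1 : ∫ t in (0 : ℝ)..|r|, t * h t ≤ ∫ t in Set.Ioi (0 : ℝ), t * h t := by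
    rw [intervalIntegral.integral_of_le (abs_nonneg r)]
    refine setIntegral_mono_set hi ?_ Set.Ioc_subset_Ioi_self.eventuallyLE
    filter_upwards [ae_restrict_mem measurableSet_Ioi] with t ht
    exact mul_nonneg (le_of_lt ht) (h0 t (le_of_lt ht))
  rw [radialPotential_eq hh (abs_nonneg r)]
  nlinarith [mul_nonneg (sq_nonneg |r|) hM]

end Potential

/-! ### Radial functions and the Laplacian on three-dimensional space -/

section Radial

theorem laplacian_eq_sum_fderiv (w : E3 → ℝ) (x : E3) :
    (Δ w) x = ∑ i : Fin 3, fderiv ℝ (fderiv ℝ w) x (EuclideanSpace.basisFun (Fin 3) ℝ i)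
      (EuclideanSpace.basisFun (Fin 3) ℝ i) := by
  rw [InnerProductSpace.laplacian_eq_iteratedFDeriv_orthonormalBasis w
    (EuclideanSpace.basisFun (Fin 3) ℝ)]
  simp [iteratedFDeriv_two_apply]

/-- If the gradient of `w` is the radial field `x ↦ n(x) x`, then `Δ w = div (n(x) x)`. -/
theorem laplacian_of_radial_fderiv {w n : E3 → ℝ} {x : E3}
    (hw : ∀ᶠ y in 𝓝 x, fderiv ℝ w y = n y • innerSL ℝ y) (hn : DifferentiableAt ℝ n x) :
    (Δ w) x = 3 * n x + fderiv ℝ n x x := by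
  let B : E3 →L[ℝ] E3 →L[ℝ] ℝ := innerSL ℝ
  have hB : ∀ y z : E3, B y z = inner ℝ y z := fun y z => rfl
  have h1 : HasFDerivAt (fun y : E3 => n y • innerSL ℝ y)
      (n x • B + (fderiv ℝ n x).smulRight (B x)) x :=
    hn.hasFDerivAt.smul B.hasFDerivAt
  have h2 : fderiv ℝ (fderiv ℝ w) x = n x • B + (fderiv ℝ n x).smulRight (B x) :=
    (h1.congr_of_eventuallyEq hw).fderiv
  rw [laplacian_eq_sum_fderiv, h2]
  have h3 : fderiv ℝ n x x = ∑ i : Fin 3, x i * fderiv ℝ n x (EuclideanSpace.single i 1) := by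
    have := congrArg (fderiv ℝ n x) ((EuclideanSpace.basisFun (Fin 3) ℝ).sum_repr x).symm
    simpa only [map_sum, map_smul, EuclideanSpace.basisFun_repr, EuclideanSpace.basisFun_apply,
      smul_eq_mul] using this
  rw [h3]
  simp only [Fin.sum_univ_three]
  simp [hB, EuclideanSpace.inner_single_right]
  ring

theorem rayMean_comp_norm (j : ℕ) (h : ℝ → ℝ) (x : E3) :
    rayMean j (fun y : E3 => h ‖y‖) x = rayMean j h ‖x‖ := by
  refine intervalIntegral.integral_congr fun σ hσ => ?_
  rw [Set.uIcc_of_le zero_le_one] at hσ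
  simp [norm_smul, abs_of_nonneg hσ.1]

theorem hasFDerivAt_radialPotential_norm {h : ℝ → ℝ} (hh : Continuous h) (x : E3) :
    HasFDerivAt (fun y : E3 => radialPotential h ‖y‖)
      (rayMean 2 (fun y : E3 => h ‖y‖) x • innerSL ℝ x) x := by
  have h1 := (hasDerivAt_half_integral_sqrt hh (‖x‖ ^ 2)).comp_hasFDerivAt x
    (hasFDerivAt_id x).norm_sq
  rw [Real.sqrt_sq (norm_nonneg x)] at h1
  convert! h1 using 1
  rw [rayMean_comp_norm]
  ext y
  simp
  ring

theorem contDiff_radialPotential_norm {h : ℝ → ℝ} (hh : Continuous h) (k : ℕ)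
    (hH : ContDiff ℝ k (fun x : E3 => h ‖x‖)) :
    ContDiff ℝ ((k + 1 : ℕ)) (fun x : E3 => radialPotential h ‖x‖) := by
  push_cast
  rw [contDiff_succ_iff_fderiv]
  refine ⟨fun x => (hasFDerivAt_radialPotential_norm hh x).differentiableAt, by simp, ?_⟩
  rw [funext fun x => (hasFDerivAt_radialPotential_norm hh x).fderiv]
  exact (contDiff_rayMean 2 k hH).smul (innerSL ℝ (E := E3)).contDiff

theorem laplacian_radialPotential_norm {h : ℝ → ℝ} (hh : Continuous h)
    (hH : ContDiff ℝ 1 (fun x : E3 => h ‖x‖)) (x : E3) :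
    (Δ (fun x : E3 => radialPotential h ‖x‖)) x = h ‖x‖ := by
  have hM : DifferentiableAt ℝ (rayMean 2 (fun y : E3 => h ‖y‖)) x :=
    (contDiff_rayMean 2 1 hH).differentiable (by norm_num) x
  rw [laplacian_of_radial_fderiv
    (Eventually.of_forall fun y => (hasFDerivAt_radialPotential_norm hh y).fderiv) hM]
  exact three_smul_rayMean_add_fderiv hH.continuous hM

theorem laplacian_comp_linearIsometryEquiv {w : E3 → ℝ} (hw : ContDiff ℝ 2 w)
    (A : E3 ≃ₗᵢ[ℝ] E3) (x : E3) : (Δ (fun y => w (A y))) x = (Δ w) (A x) := by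
  rw [InnerProductSpace.laplacian_eq_iteratedFDeriv_orthonormalBasis _
    (EuclideanSpace.basisFun (Fin 3) ℝ),
    InnerProductSpace.laplacian_eq_iteratedFDeriv_orthonormalBasis w
    ((EuclideanSpace.basisFun (Fin 3) ℝ).map A)]
  refine Finset.sum_congr rfl fun i _ => ?_
  have := (A.toContinuousLinearEquiv : E3 →L[ℝ] E3).iteratedFDeriv_comp_right hw x (i := 2) le_rfl
  change iteratedFDeriv ℝ 2 (w ∘ A) x _ = _
  change iteratedFDeriv ℝ 2 (w ∘ A) x = _ at this
  rw [this]
  simp only [ContinuousMultilinearMap.compContinuousLinearMap_apply, OrthonormalBasis.map_apply]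
  congr 1
  ext j : 1
  fin_cases j <;> rfl

/-- The derivative of a function invariant under linear isometries annihilates every direction
orthogonal to the base point: the reflection in the line through `x` fixes `x` and reverses such a
direction. -/
theorem fderiv_eq_of_invariant {w : E3 → ℝ} (hw : Differentiable ℝ w)
    (hinv : ∀ (A : E3 ≃ₗᵢ[ℝ] E3) (x : E3), w (A x) = w x) {x : E3} (hx : x ≠ 0) :
    fderiv ℝ w x = (fderiv ℝ w x x / ‖x‖ ^ 2) • innerSL ℝ x := by
  have hperp : ∀ y : E3, inner ℝ x y = 0 → fderiv ℝ w x y = 0 := by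
    intro y hy
    set R := (ℝ ∙ x).reflection
    have hRx : R x = x :=
      Submodule.reflection_mem_subspace_eq_self (Submodule.mem_span_singleton_self x)
    have hRy : R y = -y := Submodule.reflection_mem_subspace_orthogonalComplement_eq_neg
      (Submodule.mem_orthogonal_singleton_iff_inner_right.2 hy)
    have h1 : HasFDerivAt w (fderiv ℝ w x) (R x) := by rw [hRx]; exact (hw x).hasFDerivAt
    have h2 : HasFDerivAt (w ∘ R) ((fderiv ℝ w x).comp (R.toContinuousLinearEquiv : E3 →L[ℝ] E3))
      x := h1.comp x (R.toContinuousLinearEquiv : E3 →L[ℝ] E3).hasFDerivAt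
    rw [show w ∘ R = w from funext (hinv R)] at h2
    have h3 := congrArg (fun L : E3 →L[ℝ] ℝ => L y) ((hw x).hasFDerivAt.unique h2)
    have h4 : fderiv ℝ w x y = fderiv ℝ w x (R y) := h3
    rw [hRy, map_neg] at h4
    linarith
  have hx2 : ‖x‖ ^ 2 ≠ 0 := by positivity
  ext y
  have h1 := hperp (y - (inner ℝ x y / ‖x‖ ^ 2) • x) (by
    rw [inner_sub_right, inner_smul_right, real_inner_self_eq_norm_sq]
    field_simp
    ring)
  rw [map_sub, map_smul, sub_eq_zero] at h1
  rw [h1]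
  simp
  ring

/-- A `C²` function invariant under linear isometries is, along every ray, its value at the origin
plus the radial potential of its Laplacian. -/
theorem eq_radialPotential_laplacian {w : E3 → ℝ} (hw : ContDiff ℝ 2 w)
    (hinv : ∀ (A : E3 ≃ₗᵢ[ℝ] E3) (x : E3), w (A x) = w x) {e : E3} (he : ‖e‖ = 1)
    (hΔ : Continuous (Δ w)) {r : ℝ} (hr : 0 ≤ r) :
    w (r • e) = w 0 + radialPotential (fun t => (Δ w) (t • e)) r := by
  have hd : Differentiable ℝ w := hw.differentiable (by norm_num)
  set v : ℝ → ℝ := fun t => (Δ w) (t • e) with hv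
  have hvc : Continuous v := by fun_prop
  set φ' : ℝ → ℝ := fun t => fderiv ℝ w (t • e) e with hφ'
  have hray : ∀ t : ℝ, HasDerivAt (fun t : ℝ => t • e) e t := fun t => by
    simpa using (hasDerivAt_id t).smul_const e
  have hφ : ∀ t : ℝ, HasDerivAt (fun t : ℝ => w (t • e)) (φ' t) t := fun t =>
    (hd (t • e)).hasFDerivAt.comp_hasDerivAt t (hray t)
  have hφc : Continuous φ' :=
    ((hw.continuous_fderiv (by norm_num)).comp (by fun_prop)).clm_apply continuous_const
  -- The divergence form of the radial Laplacian: `(t² φ')' = t² v`.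
  have hflux : ∀ t : ℝ, 0 < t → HasDerivAt (fun t => t ^ 2 * φ' t) (t ^ 2 * v t) t := by
    intro t ht
    have hx : t • e ≠ 0 := by
      rw [← norm_ne_zero_iff, norm_smul, he]; simp [ht.ne']
    set n : E3 → ℝ := fun y => fderiv ℝ w y y / ‖y‖ ^ 2 with hn
    have hnd : DifferentiableAt ℝ n (t • e) := by
      have h1 : DifferentiableAt ℝ (fderiv ℝ w) (t • e) :=
        (hw.fderiv_right (m := 1) (by norm_num)).differentiable (by norm_num) _
      have h2 : DifferentiableAt ℝ (fun y => fderiv ℝ w y y) (t • e) :=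
        h1.clm_apply differentiableAt_id
      have h3 : DifferentiableAt ℝ (fun y : E3 => ‖y‖ ^ 2) (t • e) := differentiableAt_id.norm_sq ℝ
      simp only [hn, div_eq_mul_inv]
      exact h2.fun_mul (h3.fun_inv (pow_ne_zero 2 (norm_ne_zero_iff.2 hx)))
    have hlap := laplacian_of_radial_fderiv (w := w) (n := n) (x := t • e)
      ((eventually_ne_nhds hx).mono fun y hy => fderiv_eq_of_invariant hd hinv hy) hnd
    have h2 := (hasDerivAt_pow 3 t).mul (hnd.hasFDerivAt.comp_hasDerivAt t (hray t))
    have h3 : HasDerivAt (fun t => t ^ 2 * φ' t)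
        ((3 : ℕ) * t ^ 2 * n (t • e) + t ^ 3 * fderiv ℝ n (t • e) e) t := by
      refine h2.congr_of_eventuallyEq ?_
      filter_upwards [lt_mem_nhds ht] with s hs
      simp only [Pi.mul_apply, Function.comp, hn, hφ', map_smul, norm_smul, he, smul_eq_mul,
        Real.norm_of_nonneg hs.le]
      field_simp
    convert! h3 using 1
    simp only [hv, hlap, map_smul, smul_eq_mul]
    push_cast
    ring
  have hφ'eq : ∀ t : ℝ, 0 < t → φ' t = t * rayMean 2 v t := by
    intro t ht
    have h1 := intervalIntegral.integral_eq_sub_of_hasDerivAt_of_le ht.le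
      (f := fun t => t ^ 2 * φ' t) (f' := fun t => t ^ 2 * v t)
      (Continuous.continuousOn (by fun_prop)) (fun s hs => hflux s hs.1)
      (Continuous.intervalIntegrable (by fun_prop) _ _)
    have h2 := pow_smul_rayMean 2 v (1 : ℝ) t
    simp only [smul_eq_mul, mul_one] at h2
    rw [← h2] at h1
    have h3 : t ^ 2 * (t * rayMean 2 v t) = t ^ 2 * φ' t := by linear_combination h1
    exact (mul_left_cancel₀ (by positivity) h3).symm
  have hWc := continuous_radialPotential hvc
  have hwc := hw.continuous
  have h4 := intervalIntegral.integral_eq_sub_of_hasDerivAt_of_le hr (f' := fun _ => 0)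
    (f := fun t => w (t • e) - radialPotential v t)
    (Continuous.continuousOn (by fun_prop)) (fun t ht => by
      convert! (hφ t).sub (hasDerivAt_radialPotential hvc ht.1.le) using 1
      rw [hφ'eq t ht.1, sub_self]) intervalIntegrable_const
  simp at h4
  linarith

theorem contDiff_laplacian {w : E3 → ℝ} {k : ℕ} (hw : ContDiff ℝ (k + 2 : ℕ) w) :
    ContDiff ℝ k (Δ w) := by
  rw [funext (laplacian_eq_sum_fderiv w)]
  have h1 : ContDiff ℝ k (fderiv ℝ (fderiv ℝ w)) :=
    (hw.fderiv_right (m := (k + 1 : ℕ)) (by norm_cast)).fderiv_right (by norm_cast)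
  exact ContDiff.sum fun i _ => (h1.clm_apply contDiff_const).clm_apply contDiff_const

end Radial

/-! ### Negative powers of a quadratic -/

section Quadratic

variable {q κ a : ℝ}

theorem hasDerivAt_quadratic_rpow (hq : 1 < q) (hκ : 0 < κ) (ha : 0 < a) (t : ℝ) :
    HasDerivAt (fun t : ℝ => -((a + κ * t ^ 2) ^ (1 - q) / (2 * κ * (q - 1))))
      (t * (a + κ * t ^ 2) ^ (-q)) t := by
  have hpos : 0 < a + κ * t ^ 2 := by positivity
  have h1 : HasDerivAt (fun t : ℝ => a + κ * t ^ 2) (κ * (2 * t)) t := by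
    simpa using ((hasDerivAt_pow 2 t).const_mul κ).const_add a
  have h2 := ((h1.rpow_const (p := 1 - q) (Or.inl hpos.ne')).div_const (2 * κ * (q - 1))).neg
  convert! h2 using 1
  have h3 : q - 1 ≠ 0 := by linarith
  rw [show 1 - q - 1 = -q by ring]
  field_simp
  ring

theorem tendsto_quadratic_rpow (hq : 1 < q) (hκ : 0 < κ) :
    Tendsto (fun t : ℝ => -((a + κ * t ^ 2) ^ (1 - q) / (2 * κ * (q - 1)))) atTop (𝓝 0) := by
  have h1 : Tendsto (fun t : ℝ => a + κ * t ^ 2) atTop atTop :=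
    tendsto_atTop_add_const_left _ _ ((tendsto_pow_atTop two_ne_zero).const_mul_atTop hκ)
  have h2 := (tendsto_rpow_neg_atTop (y := q - 1) (by linarith)).comp h1
  rw [neg_sub] at h2
  simpa [Function.comp_def] using (h2.div_const (2 * κ * (q - 1))).neg

theorem integrableOn_quadratic_rpow (hq : 1 < q) (hκ : 0 < κ) (ha : 0 < a) :
    IntegrableOn (fun t : ℝ => t * (a + κ * t ^ 2) ^ (-q)) (Set.Ioi 0) :=
  integrableOn_Ioi_deriv_of_nonneg' (fun t _ => hasDerivAt_quadratic_rpow hq hκ ha t)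
    (fun t (ht : 0 < t) => by positivity) (tendsto_quadratic_rpow hq hκ)

theorem integral_quadratic_rpow (hq : 1 < q) (hκ : 0 < κ) (ha : 0 < a) :
    ∫ t in Set.Ioi (0 : ℝ), t * (a + κ * t ^ 2) ^ (-q) = a ^ (1 - q) / (2 * κ * (q - 1)) := by
  rw [integral_Ioi_of_hasDerivAt_of_nonneg' (fun t _ => hasDerivAt_quadratic_rpow hq hκ ha t)
    (fun t (ht : 0 < t) => by positivity) (tendsto_quadratic_rpow hq hκ)]
  simp

theorem abs_rpow_neg_sub_le (hq : 0 < q) {m x y : ℝ} (hm : 0 < m) (hx : m ≤ x) (hy : m ≤ y) :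
    |x ^ (-q) - y ^ (-q)| ≤ q * m ^ (-q - 1) * |x - y| := by
  refine Convex.norm_image_sub_le_of_norm_hasDerivWithin_le (s := Set.Ici m)
    (f := fun z : ℝ => z ^ (-q)) (f' := fun z => -q * z ^ (-q - 1)) (fun z hz => ?_)
    (fun z hz => ?_) (convex_Ici m) hy hx
  · exact (Real.hasDerivAt_rpow_const (Or.inl (hm.trans_le hz).ne')).hasDerivWithinAt
  · have hz0 : 0 < z := hm.trans_le hz
    rw [norm_mul, norm_neg, Real.norm_of_nonneg hq.le, Real.norm_of_nonneg (by positivity)]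
    exact mul_le_mul_of_nonneg_left (Real.rpow_le_rpow_of_nonpos hm hz (by linarith)) hq.le

end Quadratic

/-! ### The fixed-point problem -/

section FixedPoint

/-- The radial profile with value `a` at the origin and Laplacian `6κ + |h|`. The absolute value
keeps the profile above `a + κ r²` for every `h`; it has no effect on nonnegative `h`. -/
noncomputable def profileOf (κ a : ℝ) (h : ℝ → ℝ) (r : ℝ) : ℝ :=
  a + radialPotential (fun t => 6 * κ + |h t|) r

/-- The source term `u ^ (-q)` generated by the profile `u` of `h`. -/
noncomputable def sourceOf (q κ a : ℝ) (h : ℝ → ℝ) (r : ℝ) : ℝ :=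
  profileOf κ a h r ^ (-q)

variable {q κ a : ℝ} {h k : ℝ → ℝ}

theorem continuous_profileOf (hh : Continuous h) : Continuous (profileOf κ a h) :=
  continuous_const.add (continuous_radialPotential (by fun_prop))

theorem quadratic_le_profileOf (hh : Continuous h) (r : ℝ) :
    a + κ * r ^ 2 ≤ profileOf κ a h r := by
  have h1 := radialPotential_mono (h := fun _ => 6 * κ) (k := fun t => 6 * κ + |h t|)
    continuous_const (by fun_prop) (fun t _ => by simp) r
  rw [radialPotential_const] at h1
  unfold profileOf
  linarith

theorem profileOf_pos (hκ : 0 < κ) (ha : 0 < a) (hh : Continuous h) (r : ℝ) :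
    0 < profileOf κ a h r :=
  lt_of_lt_of_le (by positivity) (quadratic_le_profileOf hh r)

theorem continuous_sourceOf (hκ : 0 < κ) (ha : 0 < a) (hh : Continuous h) :
    Continuous (sourceOf q κ a h) :=
  (continuous_profileOf hh).rpow_const fun r => Or.inl (profileOf_pos hκ ha hh r).ne'

theorem sourceOf_nonneg (hκ : 0 < κ) (ha : 0 < a) (hh : Continuous h) (r : ℝ) :
    0 ≤ sourceOf q κ a h r :=
  Real.rpow_nonneg (profileOf_pos hκ ha hh r).le _

theorem sourceOf_le (hq : 1 < q) (hκ : 0 < κ) (ha : 0 < a) (hh : Continuous h) (r : ℝ) :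
    sourceOf q κ a h r ≤ (a + κ * r ^ 2) ^ (-q) :=
  Real.rpow_le_rpow_of_nonpos (by positivity) (quadratic_le_profileOf hh r) (by linarith)

theorem integrableOn_sourceOf (hq : 1 < q) (hκ : 0 < κ) (ha : 0 < a) (hh : Continuous h) :
    IntegrableOn (fun t => t * sourceOf q κ a h t) (Set.Ioi 0) := by
  refine (integrableOn_quadratic_rpow hq hκ ha).mono'
    (continuous_id.mul (continuous_sourceOf hκ ha hh)).aestronglyMeasurable ?_
  filter_upwards [ae_restrict_mem measurableSet_Ioi] with t (ht : 0 < t)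
  rw [norm_mul, Real.norm_of_nonneg ht.le, Real.norm_of_nonneg (sourceOf_nonneg hκ ha hh t)]
  exact mul_le_mul_of_nonneg_left (sourceOf_le hq hκ ha hh t) ht.le

theorem abs_profileOf_sub_le (hh : Continuous h) (hk : Continuous k) {δ : ℝ}
    (hδ : ∀ t, |h t - k t| ≤ δ) (r : ℝ) :
    |profileOf κ a h r - profileOf κ a k r| ≤ δ * r ^ 2 / 6 := by
  have h1 := abs_radialPotential_sub_le (h := fun t => 6 * κ + |h t|)
    (k := fun t => 6 * κ + |k t|) (by fun_prop) (by fun_prop) (g := fun _ => δ) continuous_const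
    (fun t _ => by
      rw [add_sub_add_left_eq_sub]
      exact (abs_abs_sub_abs_le _ _).trans (hδ t)) r
  rw [radialPotential_const] at h1
  simpa only [profileOf, add_sub_add_left_eq_sub] using h1

theorem abs_sourceOf_sub_le (hq : 1 < q) (hκ : 0 < κ) (ha : 0 < a) (hh : Continuous h)
    (hk : Continuous k) {δ : ℝ} (hδ : ∀ t, |h t - k t| ≤ δ) (r : ℝ) :
    |sourceOf q κ a h r - sourceOf q κ a k r| ≤
      q * δ / (6 * κ) * (a + κ * r ^ 2) ^ (-q) := by
  have hm : 0 < a + κ * r ^ 2 := by positivity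
  have hδ0 : 0 ≤ δ := (abs_nonneg _).trans (hδ 0)
  have h1 := abs_rpow_neg_sub_le (q := q) (by linarith) hm (quadratic_le_profileOf hh r)
    (quadratic_le_profileOf hk r)
  have h2 := abs_profileOf_sub_le (κ := κ) (a := a) hh hk hδ r
  have h3 : r ^ 2 ≤ (a + κ * r ^ 2) / κ := by
    rw [le_div_iff₀ hκ]; linarith
  calc |sourceOf q κ a h r - sourceOf q κ a k r|
      ≤ q * (a + κ * r ^ 2) ^ (-q - 1) * (δ * ((a + κ * r ^ 2) / κ) / 6) :=
        h1.trans (mul_le_mul_of_nonneg_left (h2.trans (by gcongr)) (by positivity))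
    _ = q * δ / (6 * κ) * ((a + κ * r ^ 2) ^ (-q - 1) * (a + κ * r ^ 2)) := by
        field_simp
    _ = _ := by
        rw [← Real.rpow_add_one hm.ne']
        ring_nf

/-- The operator whose fixed points are the profiles of `Δ u - 6κ` for the solutions `u` with
`u(0) = a`: it sends `h` to the potential of the source term, normalized to vanish at infinity. -/
noncomputable def tailPotential (q κ a : ℝ) (h : ℝ → ℝ) (r : ℝ) : ℝ :=
  (∫ t in Set.Ioi (0 : ℝ), t * sourceOf q κ a h t) - radialPotential (sourceOf q κ a h) r

theorem continuous_tailPotential (hκ : 0 < κ) (ha : 0 < a) (hh : Continuous h) :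
    Continuous (tailPotential q κ a h) :=
  continuous_const.sub (continuous_radialPotential (continuous_sourceOf hκ ha hh))

theorem tailPotential_nonneg (hq : 1 < q) (hκ : 0 < κ) (ha : 0 < a) (hh : Continuous h) (r : ℝ) :
    0 ≤ tailPotential q κ a h r :=
  sub_nonneg.2 (radialPotential_le_integral (continuous_sourceOf hκ ha hh)
    (fun t _ => sourceOf_nonneg hκ ha hh t) (integrableOn_sourceOf hq hκ ha hh) r)

theorem tailPotential_le (hκ : 0 < κ) (ha : 0 < a) (hh : Continuous h) (r : ℝ) :
    tailPotential q κ a h r ≤ ∫ t in Set.Ioi (0 : ℝ), t * sourceOf q κ a h t :=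
  sub_le_self _ (radialPotential_nonneg (continuous_sourceOf hκ ha hh)
    (fun t _ => sourceOf_nonneg hκ ha hh t) r)

theorem tendsto_tailPotential (hq : 1 < q) (hκ : 0 < κ) (ha : 0 < a) (hh : Continuous h) :
    Tendsto (tailPotential q κ a h) atTop (𝓝 0) := by
  have := (tendsto_radialPotential (continuous_sourceOf hκ ha hh)
    (integrableOn_sourceOf hq hκ ha hh)).const_sub
    (∫ t in Set.Ioi (0 : ℝ), t * sourceOf q κ a h t)
  rwa [sub_self] at this

theorem abs_tailPotential_sub_le (hq : 1 < q) (hκ : 0 < κ) (ha : 0 < a) (hh : Continuous h)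
    (hk : Continuous k) {δ : ℝ} (hδ : ∀ t, |h t - k t| ≤ δ) (r : ℝ) :
    |tailPotential q κ a h r - tailPotential q κ a k r| ≤
      q / (6 * κ ^ 2 * (q - 1)) * a ^ (1 - q) * δ := by
  set m : ℝ → ℝ := fun t => (a + κ * t ^ 2) ^ (-q) with hm
  set c : ℝ := q * δ / (6 * κ) with hc
  have hδ0 : 0 ≤ δ := (abs_nonneg _).trans (hδ 0)
  have hc0 : 0 ≤ c := by positivity
  have hmc : Continuous fun t => c * m t := by
    refine continuous_const.mul (Continuous.rpow_const (by fun_prop) fun t => Or.inl ?_)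
    positivity
  have hmi : IntegrableOn (fun t => t * (c * m t)) (Set.Ioi 0) := by
    refine ((integrableOn_quadratic_rpow hq hκ ha).const_mul c).congr
      (Eventually.of_forall fun t => ?_)
    simp only [hm]
    ring
  have hJ : ∫ t in Set.Ioi (0 : ℝ), t * (c * m t) = c * (a ^ (1 - q) / (2 * κ * (q - 1))) := by
    rw [← integral_quadratic_rpow hq hκ ha, ← integral_const_mul]
    congr 1 with t
    ring
  have hsrc := abs_sourceOf_sub_le hq hκ ha hh hk hδ
  have hih := integrableOn_sourceOf hq hκ ha hh
  have hik := integrableOn_sourceOf hq hκ ha hk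
  have h1 : |(∫ t in Set.Ioi (0 : ℝ), t * sourceOf q κ a h t) -
      ∫ t in Set.Ioi (0 : ℝ), t * sourceOf q κ a k t| ≤ ∫ t in Set.Ioi (0 : ℝ), t * (c * m t) := by
    rw [← integral_sub hih hik, ← Real.norm_eq_abs]
    refine norm_integral_le_of_norm_le hmi ?_
    filter_upwards [ae_restrict_mem measurableSet_Ioi] with t (ht : 0 < t)
    rw [← mul_sub, norm_mul, Real.norm_of_nonneg ht.le, Real.norm_eq_abs]
    exact mul_le_mul_of_nonneg_left (hsrc t) ht.le
  have h2 : |radialPotential (sourceOf q κ a h) r - radialPotential (sourceOf q κ a k) r| ≤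
      ∫ t in Set.Ioi (0 : ℝ), t * (c * m t) :=
    (abs_radialPotential_sub_le (continuous_sourceOf hκ ha hh) (continuous_sourceOf hκ ha hk) hmc
      (fun t _ => hsrc t) r).trans
      (radialPotential_le_integral hmc (fun t _ => by positivity) hmi r)
  have h3 : |tailPotential q κ a h r - tailPotential q κ a k r| ≤
      2 * ∫ t in Set.Ioi (0 : ℝ), t * (c * m t) := by
    unfold tailPotential
    rw [sub_sub_sub_comm, two_mul]
    exact (abs_sub _ _).trans (add_le_add h1 h2)
  refine h3.trans_eq ?_
  rw [hJ, hc]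
  have h4 : q - 1 ≠ 0 := by linarith
  field_simp

/-- Once `u(0) = a` is large, the tail operator is a contraction for the sup norm, with constant
at most `1 / 2`. -/
theorem exists_fixedPoint_tailPotential (hq : 1 < q) (hκ : 0 < κ) (ha : 0 < a)
    (hsmall : q / (6 * κ ^ 2 * (q - 1)) * a ^ (1 - q) ≤ 1 / 2) :
    ∃ h : ℝ → ℝ, Continuous h ∧ tailPotential q κ a h = h := by
  let T : BoundedContinuousFunction ℝ ℝ → BoundedContinuousFunction ℝ ℝ := fun h =>
    BoundedContinuousFunction.ofNormedAddCommGroup (tailPotential q κ a h)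
      (continuous_tailPotential hκ ha h.continuous)
      (∫ t in Set.Ioi (0 : ℝ), t * sourceOf q κ a h t) fun r => by
        rw [Real.norm_of_nonneg (tailPotential_nonneg hq hκ ha h.continuous r)]
        exact tailPotential_le hκ ha h.continuous r
  have hT : ContractingWith (1 / 2) T := by
    refine ⟨by norm_num, LipschitzWith.of_dist_le_mul fun h k => ?_⟩
    refine (BoundedContinuousFunction.dist_le (by positivity)).2 fun r => ?_
    have h1 := abs_tailPotential_sub_le hq hκ ha h.continuous k.continuous (δ := dist h k)
      (fun t => by rw [← Real.dist_eq]; exact BoundedContinuousFunction.dist_coe_le_dist t) r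
    refine h1.trans ((mul_le_mul_of_nonneg_right hsmall dist_nonneg).trans_eq ?_)
    simp
  refine ⟨hT.fixedPoint, hT.fixedPoint.continuous, ?_⟩
  exact congrArg DFunLike.coe (hT.fixedPoint_isFixedPt)

theorem eventually_contraction_bound (hq : 1 < q) :
    ∀ᶠ a : ℝ in atTop, q / (6 * κ ^ 2 * (q - 1)) * a ^ (1 - q) ≤ 1 / 2 := by
  have h1 := (tendsto_rpow_neg_atTop (y := q - 1) (by linarith)).const_mul
    (q / (6 * κ ^ 2 * (q - 1)))
  rw [neg_sub, mul_zero] at h1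
  exact h1.eventually_le_const (by norm_num)

end FixedPoint

/-! ### Solutions and their growth -/

section Solutions

variable {q κ a : ℝ} {h : ℝ → ℝ}

theorem laplacian_const_add_potential {g : ℝ → ℝ} (hg : Continuous g)
    (hG : ContDiff ℝ 1 (fun x : E3 => g ‖x‖)) (c : ℝ) (x : E3) :
    (Δ (fun x : E3 => c + radialPotential g ‖x‖)) x = g ‖x‖ := by
  have h1 : ContDiff ℝ 2 (fun x : E3 => radialPotential g ‖x‖) :=
    contDiff_radialPotential_norm hg 1 hG
  have h2 := (contDiff_const (c := c)).contDiffAt.laplacian_add (x := x) h1.contDiffAt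
  rw [laplacian_radialPotential_norm hg hG] at h2
  simpa [Pi.add_def] using h2

/-- Bootstrapping: each of the two potentials in `u ↦ u ^ (-q) ↦ Δ u ↦ u` gains one derivative, so
every round gains two. -/
theorem contDiff_profileOf_norm (hκ : 0 < κ) (ha : 0 < a) (hh : Continuous h)
    (hfix : tailPotential q κ a h = h) (h0 : ∀ t, |h t| = h t) (j : ℕ) :
    ContDiff ℝ (2 * j : ℕ) (fun x : E3 => profileOf κ a h ‖x‖) ∧
      ContDiff ℝ (2 * j + 1 : ℕ) (fun x : E3 => h ‖x‖) := by
  have step : ∀ i : ℕ, ContDiff ℝ i (fun x : E3 => profileOf κ a h ‖x‖) →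
      ContDiff ℝ (i + 1 : ℕ) (fun x : E3 => h ‖x‖) := by
    intro i hi
    have h1 : ContDiff ℝ i (fun x : E3 => sourceOf q κ a h ‖x‖) :=
      hi.rpow_const_of_ne fun x => (profileOf_pos hκ ha hh ‖x‖).ne'
    have h2 := contDiff_radialPotential_norm (continuous_sourceOf hκ ha hh) i h1
    rw [show (fun x : E3 => h ‖x‖) = fun x : E3 => tailPotential q κ a h ‖x‖ by rw [hfix]]
    exact contDiff_const.sub h2
  induction j with
  | zero =>
    have h1 : ContDiff ℝ (0 : ℕ) (fun x : E3 => profileOf κ a h ‖x‖) :=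
      contDiff_zero.2 ((continuous_profileOf hh).comp continuous_norm)
    exact ⟨h1, step 0 h1⟩
  | succ j ih =>
    have h1 : ContDiff ℝ (2 * (j + 1) : ℕ) (fun x : E3 => profileOf κ a h ‖x‖) := by
      refine contDiff_const.add (contDiff_radialPotential_norm (by fun_prop) (2 * j + 1) ?_)
      simp only [h0]
      exact contDiff_const.add ih.2
    exact ⟨h1, step _ h1⟩

theorem tendsto_profileOf_div_sq (hh : Continuous h) (hl : Tendsto h atTop (𝓝 0)) :
    Tendsto (fun r => profileOf κ a h r / r ^ 2) atTop (𝓝 κ) := by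
  have h1 := tendsto_radialPotential_div_sq (h := fun t => 6 * κ + |h t|) (by fun_prop)
    (hl.abs.const_add (6 * κ))
  have h2 := (tendsto_const_nhds (x := a)).div_atTop (tendsto_pow_atTop (α := ℝ) two_ne_zero)
  have h3 := h2.add h1
  rw [abs_zero, add_zero, mul_div_cancel_left₀ _ (by norm_num), zero_add] at h3
  exact h3.congr fun r => (add_div _ _ _).symm

theorem exists_solution_of_value_at_zero (hq : 1 < q) (hκ : 0 < κ) (ha : 0 < a)
    (hsmall : q / (6 * κ ^ 2 * (q - 1)) * a ^ (1 - q) ≤ 1 / 2) :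
    ∃ u : E3 → ℝ, (IsRadial u ∧ IsPositiveSolution q u ∧ HasQuadraticGrowth κ u) ∧ u 0 = a := by
  obtain ⟨h, hh, hfix⟩ := exists_fixedPoint_tailPotential hq hκ ha hsmall
  have h0 : ∀ t, |h t| = h t := fun t => by
    rw [← hfix]
    exact abs_of_nonneg (tailPotential_nonneg hq hκ ha hh t)
  have hreg := contDiff_profileOf_norm hκ ha hh hfix h0
  have hg : ContDiff ℝ 1 (fun x : E3 => 6 * κ + |h ‖x‖|) := by
    simp only [h0]
    exact contDiff_const.add (hreg 0).2
  have hlap : Δ (fun x : E3 => profileOf κ a h ‖x‖) = fun x : E3 => 6 * κ + |h ‖x‖| :=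
    funext fun x => laplacian_const_add_potential (g := fun t => 6 * κ + |h t|) (by fun_prop) hg a x
  have hs : ContDiff ℝ 1 (fun x : E3 => sourceOf q κ a h ‖x‖) :=
    ((hreg 1).1.of_le (by norm_num)).rpow_const_of_ne fun x => (profileOf_pos hκ ha hh ‖x‖).ne'
  have hneg : ∀ r, radialPotential (fun t => -sourceOf q κ a h t) r =
      -radialPotential (sourceOf q κ a h) r := fun r => by
    have := radialPotential_sub (continuous_const (y := (0 : ℝ)))
      (continuous_sourceOf (q := q) hκ ha hh) r
    simpa [radialPotential_const] using this
  refine ⟨fun x => profileOf κ a h ‖x‖, ⟨⟨profileOf κ a h, fun x => rfl⟩,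
    ⟨(hreg 2).1, fun x => profileOf_pos hκ ha hh _, fun x => ?_⟩, ?_⟩, by simp [profileOf]⟩
  · -- At the fixed point, `Δ u` is a constant plus the potential of `-u ^ (-q)`.
    have hform : (fun x : E3 => 6 * κ + |h ‖x‖|) = fun x : E3 =>
        (6 * κ + ∫ t in Set.Ioi (0 : ℝ), t * sourceOf q κ a h t) +
          radialPotential (fun t => -sourceOf q κ a h t) ‖x‖ := by
      funext x
      rw [h0, hneg]
      nth_rw 1 [← hfix]
      unfold tailPotential
      ring
    rw [hlap, hform, laplacian_const_add_potential (g := fun t => -sourceOf q κ a h t)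
      (continuous_sourceOf hκ ha hh).neg hs.neg]
    exact neg_add_cancel _
  · have hl : Tendsto h atTop (𝓝 0) := by
      have := tendsto_tailPotential hq hκ ha hh
      rwa [hfix] at this
    exact (tendsto_profileOf_div_sq hh hl).comp tendsto_norm_cobounded_atTop

theorem integrableOn_of_tendsto_div_sq (hq : 1 < q) (hκ : 0 < κ) {w : ℝ → ℝ} (hw : Continuous w)
    (hpos : ∀ t, 0 < w t) (hlim : Tendsto (fun t => w t / t ^ 2) atTop (𝓝 κ)) :
    IntegrableOn (fun t => t * w t ^ (-q)) (Set.Ioi 0) := by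
  have hc : Continuous fun t => t * w t ^ (-q) :=
    continuous_id.mul (hw.rpow_const fun t => Or.inl (hpos t).ne')
  -- For large `t`, `w t ≥ κ t² / 2 ≥ κ / 4 + κ t² / 4`.
  obtain ⟨T, hT⟩ := eventually_atTop.1
    ((hlim.eventually_const_le (half_lt_self hκ)).and (eventually_ge_atTop 1))
  have hT1 : 1 ≤ T := (hT T le_rfl).2
  have hT0 : 0 ≤ T := by linarith
  rw [← Set.Ioc_union_Ioi_eq_Ioi hT0]
  refine IntegrableOn.union ((hc.integrableOn_Icc).mono_set Set.Ioc_subset_Icc_self) ?_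
  refine ((integrableOn_quadratic_rpow hq (κ := κ / 4) (a := κ / 4) (by positivity)
    (by positivity)).mono_set (Set.Ioi_subset_Ioi hT0)).mono' hc.aestronglyMeasurable ?_
  filter_upwards [ae_restrict_mem measurableSet_Ioi] with t (ht : T < t)
  have ht1 : 1 ≤ t := (hT t ht.le).2
  have h1 : κ / 2 * t ^ 2 ≤ w t := by
    have := (hT t ht.le).1
    rwa [le_div_iff₀ (by positivity)] at this
  have h2 : κ / 4 + κ / 4 * t ^ 2 ≤ w t := by
    nlinarith [mul_le_mul_of_nonneg_left (one_le_pow₀ ht1 (n := 2)) hκ.le]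
  rw [norm_mul, Real.norm_of_nonneg (by linarith),
    Real.norm_of_nonneg (Real.rpow_nonneg (hpos t).le _)]
  exact mul_le_mul_of_nonneg_left
    (Real.rpow_le_rpow_of_nonpos (by positivity) h2 (by linarith)) (by linarith)

end Solutions

theorem theorem3 (q κ : ℝ) (hq : 1 < q) (hκ : 0 < κ) :
    {u : E3 → ℝ | IsRadial u ∧ IsPositiveSolution q u ∧ HasQuadraticGrowth κ u}.Infinite ∧
    ∀ (u : E3 → ℝ) (f : ℝ → ℝ), IsPositiveSolution q u → HasQuadraticGrowth κ u →
      HasProfile u f →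
        IntegrableOn (fun t : ℝ => t * (f t) ^ (-q)) (Set.Ioi 0) ∧
        6 * κ = (Δ u) 0 - ∫ t in Set.Ioi (0 : ℝ), t * (f t) ^ (-q) := by
  constructor
  · obtain ⟨A, hA⟩ := eventually_atTop.1
      ((eventually_contraction_bound (κ := κ) hq).and (eventually_gt_atTop 0))
    refine Set.Infinite.of_image (fun u : E3 → ℝ => u 0) ((Set.Ici_infinite A).mono fun a ha => ?_)
    exact exists_solution_of_value_at_zero hq hκ (hA a ha).2 (hA a ha).1
  intro u f hu hgrowth hf
  set e : E3 := EuclideanSpace.single 0 1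
  have he : ‖e‖ = 1 := by simp [e]
  have hinv : ∀ (A : E3 ≃ₗᵢ[ℝ] E3) (x : E3), u (A x) = u x := fun A x => by
    rw [hf, hf, A.norm_map]
  have hu2 : ContDiff ℝ 2 u := hu.contDiff.of_le (by norm_num)
  have hv2 : ContDiff ℝ 2 (Δ u) := contDiff_laplacian (k := 2) hu.contDiff
  have hvinv : ∀ (A : E3 ≃ₗᵢ[ℝ] E3) (x : E3), (Δ u) (A x) = (Δ u) x := fun A x => by
    rw [← laplacian_comp_linearIsometryEquiv hu2]
    simp only [hinv]
  have huc : Continuous fun t : ℝ => u (t • e) := hu.contDiff.continuous.comp (by fun_prop)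
  have huf : ∀ t : ℝ, 0 < t → u (t • e) = f t := fun t ht => by
    rw [hf, norm_smul, he, mul_one, Real.norm_of_nonneg ht.le]
  have hulim : Tendsto (fun t : ℝ => u (t • e) / t ^ 2) atTop (𝓝 κ) := by
    have h1 : Tendsto (fun t : ℝ => t • e) atTop (Bornology.cobounded E3) := by
      rw [← tendsto_norm_atTop_iff_cobounded]
      simpa [norm_smul, he] using (tendsto_abs_atTop_atTop (G := ℝ))
    refine (hgrowth.comp h1).congr fun t => ?_
    simp [norm_smul, he]
  have hint := integrableOn_of_tendsto_div_sq hq hκ huc (fun t => hu.pos _) hulim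
  have hcongr : Set.EqOn (fun t : ℝ => t * u (t • e) ^ (-q)) (fun t => t * f t ^ (-q))
      (Set.Ioi 0) := fun t ht => by simp only [huf t ht]
  refine ⟨hint.congr_fun hcongr measurableSet_Ioi, ?_⟩
  rw [← setIntegral_congr_fun measurableSet_Ioi hcongr]
  have hpc : Continuous fun t : ℝ => u (t • e) ^ (-q) :=
    huc.rpow_const fun t => Or.inl (hu.pos _).ne'
  have hΔΔ : Δ (Δ u) = fun x => -(u x ^ (-q)) := funext fun x => by linarith [hu.eqn x]
  have hvray : ∀ r : ℝ, 0 ≤ r →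
      (Δ u) (r • e) = (Δ u) 0 - radialPotential (fun t => u (t • e) ^ (-q)) r := by
    intro r hr
    have h1 := eq_radialPotential_laplacian hv2 hvinv he
      (contDiff_laplacian (k := 0) hv2).continuous hr
    have h2 := radialPotential_sub (continuous_const (y := (0 : ℝ))) hpc r
    rw [hΔΔ] at h1
    simp only [radialPotential_const, zero_sub, zero_mul, zero_div] at h2
    rw [h1, h2, sub_eq_add_neg]
  have hvlim : Tendsto (fun r : ℝ => (Δ u) (r • e)) atTop
      (𝓝 ((Δ u) 0 - ∫ t in Set.Ioi (0 : ℝ), t * u (t • e) ^ (-q))) := by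
    refine ((tendsto_radialPotential hpc hint).const_sub _).congr' ?_
    filter_upwards [eventually_ge_atTop 0] with r hr
    exact (hvray r hr).symm
  have hvc : Continuous fun r : ℝ => (Δ u) (r • e) := hv2.continuous.comp (by fun_prop)
  have h1 := tendsto_radialPotential_div_sq hvc hvlim
  have h2 := ((tendsto_const_nhds (x := u 0)).div_atTop
    (tendsto_pow_atTop (α := ℝ) two_ne_zero)).add h1
  have h3 := tendsto_nhds_unique hulim (h2.congr' (by
    filter_upwards [eventually_ge_atTop 0] with r hr
    rw [eq_radialPotential_laplacian hu2 hinv he hv2.continuous hr, add_div]))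
  rw [h3]
  ring
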